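/- A planar ring is an associative ring $(N,+,*)$ (not assumed to be commutative or to have an identity) such that, writing $a\cong b$ if $x*a=x*b$ for all $x\in N$, the relation $\cong$ has at least three equivalence classes, and for all $a,b,c\in N$ with $a\not\cong b$ the equation $x*a=x*b+c$ has exactly one solution $x\in N$. Say that a group $\Phi\le\mathrm{Aut}(N,+)$, acting from the right, determines $(N,+,*)$ if every nonidentity element $\phi\in\Phi$ fixes only $0$ and the map $-\mathrm{id}+\phi$ is bijective, and there are a set $R\subseteq N\setminus\{0\}$ of representatives of the nonzero $\Phi$-orbits and a subset $M\subseteq R$ such that $a*0=0$ for all $a\in N$ and, for $a\in N$, $r\in R$, $\phi\in\Phi$, one has $a*(r\phi)=0$ if $r\in M$ and $a*(r\phi)=a\phi$ if $r\notin M$. Corollary (Aichinger). Let $N$ be a planar ring. Then there are exactly one group $\Phi$ that determines $N$, a (not necessarily commutative) field $F$, that is, a division ring, and a right $F$-vector space structure on $(N,+)$ such that $\Phi=F^*$, i.e. $\Phi$ is the group of all maps $v\mapsto vf$ with $f\in F\setminus\{0\}$. If $N$ is finite, then $F$ is a commutative field. -/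

import Mathlib

universe u

/-- `a` and `b` are equivalent multipliers: `x * a = x * b` for all `x`. -/
def EquivMultiplier {N : Type*} [Mul N] (a b : N) : Prop :=
  ∀ x : N, x * a = x * b

/-- Planarity of a (right) nearring. -/
structure IsPlanar (N : Type*) [Add N] [Mul N] : Prop where
  /-- The equivalence relation `EquivMultiplier` has at least three classes. -/
  three_classes : ∃ a b c : N,
    ¬ EquivMultiplier a b ∧ ¬ EquivMultiplier a c ∧ ¬ EquivMultiplier b c
  /-- `x * a = x * b + c` is uniquely solvable whenever `a`, `b` are inequivalent. -/
  existsUnique_solution : ∀ a b c : N, ¬ EquivMultiplier a b → ∃! x : N, x * a = x * b + c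

/-- `Φ` is an automorphism group from which the multiplication of `N` is derived: `Φ` acts on
`(N, +)` without fixed points, `-id + φ` is bijective for `id ≠ φ ∈ Φ`, and for some set `R` of
representatives of the nonzero orbits and some `M ⊆ R` the product of `a` and `b = r φ_b`
(with `r ∈ R`, `φ_b ∈ Φ`) is `0` if `r ∈ M` and is `a φ_b` otherwise.
The group `Aut (N, +)` is `AddAut N`, whose operation, composition, Mathlib writes additively. -/
structure IsPlanarAutGroup (N : Type*) [AddGroup N] [Mul N] (Φ : AddSubgroup (AddAut N)) :
    Prop where
  fixedPointFree : ∀ φ ∈ Φ, φ ≠ AddEquiv.refl N → ∀ n : N, φ n = n → n = 0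
  bijective : ∀ φ ∈ Φ, φ ≠ AddEquiv.refl N → Function.Bijective (fun n : N => -n + φ n)
  mul_eq : ∃ R M : Set N,
    (0 : N) ∉ R ∧
    (∀ a : N, a ≠ 0 → ∃! r : N, r ∈ R ∧ ∃ φ ∈ Φ, φ r = a) ∧
    M ⊆ R ∧
    ∀ a : N, a * 0 = 0 ∧
      (∀ r ∈ M, ∀ φ ∈ Φ, a * φ r = 0) ∧
      (∀ r ∈ R, r ∉ M → ∀ φ ∈ Φ, a * φ r = φ a)

/-- For a right vector space `V` over `F` (a module over the opposite ring of `F`), the group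
`F*` of all scalar multiplications `v ↦ v f`, `f ≠ 0`, as a group of automorphisms of `(V, +)`. -/
def scalarGroup (F V : Type*) [DivisionRing F] [AddCommGroup V] [Module Fᵐᵒᵖ V] :
    AddSubgroup (AddAut V) where
  carrier := {φ | ∃ f : F, f ≠ 0 ∧ ∀ v : V, φ v = MulOpposite.op f • v}
  zero_mem' := ⟨1, one_ne_zero, fun v => by simp⟩
  add_mem' := by
    rintro φ ψ ⟨f, hf, hφ⟩ ⟨g, hg, hψ⟩
    refine ⟨g * f, mul_ne_zero hg hf, fun v => ?_⟩
    rw [AddAut.add_apply, hφ, hψ, smul_smul, ← MulOpposite.op_mul]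
  neg_mem' := by
    rintro φ ⟨f, hf, hφ⟩
    refine ⟨f⁻¹, inv_ne_zero hf, fun v => ?_⟩
    apply φ.injective
    rw [AddAut.apply_neg_self, hφ, smul_smul, ← MulOpposite.op_mul, inv_mul_cancel₀ hf]
    simp

/-! Planarity with `b = 0` makes right multiplication by every non-annihilating element bijective.
This gives a right identity `e`, so the right multiplications form a ring of endomorphisms whose
nonzero elements are units (`isUnit_or_eq_zero`); `F` is its opposite. A group determines `N`
exactly when it consists of all bijective right multiplications (`mem_iff_of_isPlanarAutGroup`,
`isPlanarAutGroup_of_mem_iff`), which is `F*`. -/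

namespace IsPlanar

variable {N : Type u} [NonUnitalRing N]

/-- Right multiplication by an element that does not annihilate `N` is bijective. -/
theorem bijective_mul_right (hN : IsPlanar N) {a : N} (ha : ¬ EquivMultiplier a 0) :
    Function.Bijective (fun x : N => x * a) := by
  rw [Function.bijective_iff_existsUnique]
  intro c
  simpa using hN.existsUnique_solution a 0 c ha

theorem exists_not_equivMultiplier_zero (hN : IsPlanar N) :
    ∃ a : N, ¬ EquivMultiplier a 0 := by
  obtain ⟨a, b, -, hab, -, -⟩ := hN.three_classes
  by_contra! h
  exact hab fun x => (h a x).trans (h b x).symm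

/-- Solve `e * a = a`; then `x * e * a = x * a`, and `a` cancels on the right. -/
theorem exists_right_identity (hN : IsPlanar N) : ∃ e : N, ∀ x : N, x * e = x := by
  obtain ⟨a, ha⟩ := hN.exists_not_equivMultiplier_zero
  obtain ⟨e, he⟩ := (hN.bijective_mul_right ha).2 a
  refine ⟨e, fun x => (hN.bijective_mul_right ha).1 ?_⟩
  change x * e * a = x * a
  rw [mul_assoc, show e * a = a from he]

theorem exists_inverse (hN : IsPlanar N) {a : N} (ha : ¬ EquivMultiplier a 0) :
    ∃ b : N, (∀ x : N, x * a * b = x) ∧ ∀ x : N, x * b * a = x := by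
  obtain ⟨e, he⟩ := hN.exists_right_identity
  obtain ⟨b, hb⟩ := (hN.bijective_mul_right ha).2 e
  have hba : ∀ x : N, x * b * a = x := fun x => by
    rw [mul_assoc, show b * a = e from hb, he]
  exact ⟨b, fun x => (hN.bijective_mul_right ha).1 (hba (x * a)), hba⟩

theorem nontrivial (hN : IsPlanar N) : Nontrivial N := by
  obtain ⟨a, ha⟩ := hN.exists_not_equivMultiplier_zero
  refine ⟨a, 0, ?_⟩
  rintro rfl
  exact ha fun _ => rfl

/-- An automorphism that is a right multiplication comes from a non-annihilating element. -/
theorem not_equivMultiplier_zero_of_addAut (hN : IsPlanar N) {φ : AddAut N} {a : N}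
    (h : ∀ v, φ v = v * a) : ¬ EquivMultiplier a 0 := by
  intro ha
  obtain ⟨v, hv⟩ := @exists_ne N hN.nontrivial 0
  refine hv (φ.injective ?_)
  rw [map_zero, h, ha v, mul_zero]

/-- The right multiplication by a non-annihilating element, as an automorphism. -/
theorem exists_addAut (hN : IsPlanar N) {a : N} (ha : ¬ EquivMultiplier a 0) :
    ∃ φ : AddAut N, ∀ v, φ v = v * a :=
  ⟨AddEquiv.ofBijective (AddMonoidHom.mulRight a) (hN.bijective_mul_right ha), fun _ => rfl⟩

/-- The ring of right multiplications of a ring with a right identity. -/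
def mulRightSubring {e : N} (he : ∀ x : N, x * e = x) : Subring (AddMonoid.End N) where
  carrier := {f | ∃ a : N, ∀ v, f v = v * a}
  one_mem' := ⟨e, fun v => (he v).symm⟩
  zero_mem' := ⟨0, fun v => (mul_zero v).symm⟩
  add_mem' := by
    rintro f g ⟨a, ha⟩ ⟨b, hb⟩
    exact ⟨a + b, fun v => by
      change f v + g v = _
      rw [ha, hb, mul_add]⟩
  neg_mem' := by
    rintro f ⟨a, ha⟩
    exact ⟨-a, fun v => by
      change -f v = _
      rw [ha, mul_neg]⟩
  mul_mem' := by
    rintro f g ⟨a, ha⟩ ⟨b, hb⟩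
    exact ⟨b * a, fun v => by
      change f (g v) = _
      rw [ha, hb, mul_assoc]⟩

theorem isUnit_or_eq_zero (hN : IsPlanar N) {e : N} (he : ∀ x : N, x * e = x)
    (f : mulRightSubring he) : IsUnit f ∨ f = 0 := by
  obtain ⟨f, a, ha⟩ := f
  by_cases h : EquivMultiplier a 0
  · right
    ext v
    change f v = 0
    rw [ha, h v, mul_zero]
  · left
    obtain ⟨b, hab, hba⟩ := hN.exists_inverse h
    refine ⟨⟨⟨f, a, ha⟩, ⟨AddMonoidHom.mulRight b, b, fun _ => rfl⟩, ?_, ?_⟩, rfl⟩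
    · ext v
      exact (ha (v * b)).trans (hba v)
    · ext v
      change f v * b = v
      rw [ha, hab]

/-- There is a division ring acting on `N` from the right whose scalar multiplications are exactly
the right multiplications of `N`. -/
theorem exists_divisionRing (hN : IsPlanar N) :
    ∃ (F : Type u) (_ : DivisionRing F) (_ : Module Fᵐᵒᵖ N),
      (∀ f : F, ∃ a : N, ∀ v : N, MulOpposite.op f • v = v * a) ∧
      (∀ a : N, ∃ f : F, ∀ v : N, MulOpposite.op f • v = v * a) ∧
      (Finite N → Finite F) := by
  obtain ⟨e, he⟩ := hN.exists_right_identity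
  have := hN.nontrivial
  have : Nontrivial (mulRightSubring he) := by
    obtain ⟨v, hv⟩ := exists_ne (0 : N)
    exact ⟨1, 0, fun h => hv (DFunLike.congr_fun (congrArg Subtype.val h) v)⟩
  let : DivisionRing (mulRightSubring he) :=
    DivisionRing.ofIsUnitOrEqZero (hN.isUnit_or_eq_zero he)
  -- Endomorphisms act from the left, so a right vector space structure needs the opposite ring as
  -- `F`; the double opposite is undone here.
  let : Module (mulRightSubring he)ᵐᵒᵖᵐᵒᵖ N :=
    Module.compHom N (RingEquiv.opOp (mulRightSubring he)).symm.toRingHom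
  refine ⟨(mulRightSubring he)ᵐᵒᵖ, inferInstance, inferInstance, fun f => ?_, fun a => ?_,
    fun _ => ?_⟩
  · obtain ⟨a, ha⟩ := f.unop.2
    exact ⟨a, ha⟩
  · exact ⟨MulOpposite.op ⟨AddMonoidHom.mulRight a, a, fun _ => rfl⟩, fun _ => rfl⟩
  · have : Finite (AddMonoid.End N) := DFunLike.finite _
    have : Finite (mulRightSubring he) := Subtype.finite
    exact Finite.of_equiv _ MulOpposite.opEquiv

theorem mem_scalarGroup_iff (hN : IsPlanar N) {F : Type u} [DivisionRing F] [Module Fᵐᵒᵖ N]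
    (h₁ : ∀ f : F, ∃ a : N, ∀ v : N, MulOpposite.op f • v = v * a)
    (h₂ : ∀ a : N, ∃ f : F, ∀ v : N, MulOpposite.op f • v = v * a) (φ : AddAut N) :
    φ ∈ scalarGroup F N ↔ ∃ a : N, ∀ v, φ v = v * a := by
  constructor
  · rintro ⟨f, -, hf⟩
    obtain ⟨a, ha⟩ := h₁ f
    exact ⟨a, fun v => (hf v).trans (ha v)⟩
  · rintro ⟨a, ha⟩
    obtain ⟨f, hf⟩ := h₂ a
    refine ⟨f, ?_, fun v => (ha v).trans (hf v).symm⟩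
    rintro rfl
    exact hN.not_equivMultiplier_zero_of_addAut ha fun v => by
      rw [← hf, MulOpposite.op_zero, zero_smul, mul_zero]

/-- An automorphism group that determines `N` consists of all bijective right multiplications. -/
theorem mem_iff_of_isPlanarAutGroup (hN : IsPlanar N) {Φ : AddSubgroup (AddAut N)}
    (hΦ : IsPlanarAutGroup N Φ) (φ : AddAut N) : φ ∈ Φ ↔ ∃ a : N, ∀ v, φ v = v * a := by
  obtain ⟨R, M, -, hR, -, hmul⟩ := hΦ.mul_eq
  have key : ∀ a : N, ¬ EquivMultiplier a 0 →
      ∃ r ∈ R, r ∉ M ∧ ∃ ψ ∈ Φ, ∀ v, ψ v = v * a := by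
    intro a ha
    have ha0 : a ≠ 0 := by
      rintro rfl
      exact ha fun _ => rfl
    obtain ⟨r, ⟨hr, ψ, hψ, hψr⟩, -⟩ := hR a ha0
    have hrM : r ∉ M := fun hrM => ha fun x => by
      rw [← hψr, (hmul x).2.1 r hrM ψ hψ, mul_zero]
    exact ⟨r, hr, hrM, ψ, hψ, fun v => by rw [← hψr, (hmul v).2.2 r hr hrM ψ hψ]⟩
  constructor
  · intro hφ
    obtain ⟨a, ha⟩ := hN.exists_not_equivMultiplier_zero
    obtain ⟨r, hr, hrM, -⟩ := key a ha
    -- A representative outside `M` recovers `φ` as right multiplication by `φ r`.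
    exact ⟨φ r, fun v => ((hmul v).2.2 r hr hrM φ hφ).symm⟩
  · rintro ⟨a, ha⟩
    obtain ⟨-, -, -, ψ, hψ, h⟩ := key a (hN.not_equivMultiplier_zero_of_addAut ha)
    have : φ = ψ := AddEquiv.ext fun v => (ha v).trans (h v).symm
    exact this ▸ hψ

/-- The group of all bijective right multiplications determines `N`. -/
theorem isPlanarAutGroup_of_mem_iff (hN : IsPlanar N) {Φ : AddSubgroup (AddAut N)}
    (hΦ : ∀ φ : AddAut N, φ ∈ Φ ↔ ∃ a : N, ∀ v, φ v = v * a) : IsPlanarAutGroup N Φ := by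
  obtain ⟨e, he⟩ := hN.exists_right_identity
  have hbij : ∀ φ ∈ Φ, φ ≠ AddEquiv.refl N → Function.Bijective (fun n : N => -n + φ n) := by
    intro φ hφ hne
    obtain ⟨a, ha⟩ := (hΦ φ).1 hφ
    -- `-id + φ` is right multiplication by `a - e`.
    have hae : ¬ EquivMultiplier (a - e) 0 := fun h => hne <| AddEquiv.ext fun v => by
      have := h v
      rw [mul_sub, he, mul_zero, sub_eq_zero] at this
      exact (ha v).trans this
    convert hN.bijective_mul_right hae using 2 with n
    rw [ha, mul_sub, he, neg_add_eq_sub]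
  let s : Setoid N :=
    { r := fun x y => ∃ φ ∈ Φ, φ x = y
      iseqv :=
        { refl := fun x => ⟨0, Φ.zero_mem, rfl⟩
          symm := by
            rintro x _ ⟨φ, hφ, rfl⟩
            exact ⟨-φ, Φ.neg_mem hφ, AddAut.neg_apply_self N φ x⟩
          trans := by
            rintro x _ _ ⟨φ, hφ, rfl⟩ ⟨ψ, hψ, rfl⟩
            exact ⟨ψ + φ, Φ.add_mem hψ hφ, rfl⟩ } }
  let ρ : N → N := fun x => (Quotient.mk s x).out
  have hρ : ∀ x, ∃ φ ∈ Φ, φ (ρ x) = x := fun x => Quotient.mk_out (s := s) x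
  have hρ_eq : ∀ x, ∀ φ ∈ Φ, ρ (φ x) = ρ x := fun x φ hφ =>
    congrArg Quotient.out (Quotient.sound (s := s) (s.symm ⟨φ, hφ, rfl⟩))
  -- Membership in the annihilator is constant on orbits.
  have hann : ∀ x, ∀ φ ∈ Φ, EquivMultiplier (φ x) 0 → EquivMultiplier x 0 := by
    intro x φ hφ h y
    obtain ⟨a, ha⟩ := (hΦ φ).1 hφ
    apply φ.injective
    rw [ha, mul_assoc, ← ha x, h y]
    simp
  have hann' : ∀ x, ∀ φ ∈ Φ, EquivMultiplier x 0 → EquivMultiplier (φ x) 0 := by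
    intro x φ hφ h
    refine hann (φ x) (-φ) (Φ.neg_mem hφ) ?_
    rwa [AddAut.neg_apply_self]
  -- Annihilating orbits get arbitrary representatives, via `ρ`. Each other orbit contains exactly
  -- one right identity, and `U` collects these.
  let M : Set N := {r | r ≠ 0 ∧ EquivMultiplier r 0 ∧ ρ r = r}
  let U : Set N := {r | ∀ x : N, x * r = x}
  have hU : ∀ r ∈ U, ¬ EquivMultiplier r 0 := fun r hr h => by
    obtain ⟨v, hv⟩ := @exists_ne N hN.nontrivial 0
    exact hv (by rw [← hr v, h v, mul_zero])
  have hact : ∀ r ∈ U, ∀ φ ∈ Φ, ∀ x, x * φ r = φ x := by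
    intro r hr φ hφ x
    obtain ⟨a, ha⟩ := (hΦ φ).1 hφ
    rw [ha, ha, ← mul_assoc, hr]
  refine ⟨fun φ hφ hne n hn => ?_, hbij, M ∪ U, M, ?_, ?_, Set.subset_union_left, fun a => ?_⟩
  · refine (hbij φ hφ hne).1 ?_
    simp [hn]
  · rintro (h | h)
    · exact h.1 rfl
    · exact hU 0 h fun _ => rfl
  · intro a ha0
    by_cases ha : EquivMultiplier a 0
    · obtain ⟨φ, hφ, hφa⟩ := hρ a
      refine ⟨ρ a, ⟨Or.inl ⟨?_, ?_, ?_⟩, φ, hφ, hφa⟩, ?_⟩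
      · intro h
        rw [h, map_zero] at hφa
        exact ha0 hφa.symm
      · exact hann _ φ hφ (hφa.symm ▸ ha)
      · conv_rhs => rw [← hφa]
        exact (hρ_eq _ φ hφ).symm
      · rintro r ⟨hr | hr, ψ, hψ, rfl⟩
        · rw [hρ_eq r ψ hψ, hr.2.2]
        · exact absurd (hann r ψ hψ ha) (hU r hr)
    · obtain ⟨φ, hφ⟩ := hN.exists_addAut ha
      have hφΦ : φ ∈ Φ := (hΦ φ).2 ⟨a, hφ⟩
      refine ⟨(-φ) a, ⟨Or.inr fun x => ?_, φ, hφΦ, AddAut.apply_neg_self N φ a⟩, ?_⟩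
      · apply φ.injective
        rw [hφ, mul_assoc, ← hφ ((-φ) a), AddAut.apply_neg_self, hφ]
      · rintro r ⟨hr | hr, ψ, hψ, hψr⟩
        · exact absurd (hψr ▸ hann' r ψ hψ hr.2.1) ha
        -- A right identity `r` with `ψ r = a` forces `ψ x = x * ψ r = x * a`.
        · have : ψ = φ := AddEquiv.ext fun v => by rw [hφ, ← hψr, hact r hr ψ hψ]
          rw [← hψr, ← this, AddAut.neg_apply_self]
  · refine ⟨mul_zero a, fun r hr φ hφ => ?_, fun r hr hrM φ hφ => ?_⟩
    · rw [hann' r φ hφ hr.2.1 a, mul_zero]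
    · exact hact r (hr.resolve_left hrM) φ hφ a

end IsPlanar

theorem mainTheorem8 {N : Type u} [NonUnitalRing N] (hN : IsPlanar N) :
    ∃ (F : Type u) (_ : DivisionRing F) (_ : Module Fᵐᵒᵖ N),
      (∀ Φ : AddSubgroup (AddAut N), IsPlanarAutGroup N Φ ↔ Φ = scalarGroup F N) ∧
      (Finite N → IsField F) := by
  obtain ⟨F, _, _, h₁, h₂, hfin⟩ := hN.exists_divisionRing
  have hF := hN.mem_scalarGroup_iff h₁ h₂
  refine ⟨F, inferInstance, inferInstance, fun Φ => ⟨fun hΦ => ?_, ?_⟩, fun h => ?_⟩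
  · ext φ
    rw [hN.mem_iff_of_isPlanarAutGroup hΦ, hF]
  · rintro rfl
    exact hN.isPlanarAutGroup_of_mem_iff hF
  · have := hfin h
    -- Wedderburn's little theorem.
    exact Finite.isDomain_to_isField F
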